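/- Let $n\ge 2$, $k\ge 1$, $d=n^2$, and $\mathcal H=\mathcal H_A\otimes\mathcal H_B$ with $\mathcal H_A=\mathcal H_B=\mathbb C^n$. Let $\pi_{d,k}$ be the distribution of $\rho=\operatorname{tr}_R|\phi\rangle\langle\phi|$, where $|\phi\rangle$ is uniformly distributed on the unit sphere of $\mathcal H\otimes\mathbb C^k$ and $\operatorname{tr}_R$ is the partial trace over $\mathbb C^k$. Let $\mathrm{SEP}$ be the convex hull of the pure product states of $\mathcal H$. A vector $|\Phi\rangle\in\mathcal H$ is maximally entangled if $|\Phi\rangle=(U_A\otimes U_B)\frac1{\sqrt n}\sum_{i=1}^n|ii\rangle$ for some unitary $U_A,U_B$. Let $\mathrm{FE}$ be the set of faithfully entangled states, i.e. of density matrices $\rho\notin\mathrm{SEP}$ such that $\operatorname{tr}\big[\rho\big(\frac{\mathbb I}{\sqrt d}-|\Phi\rangle\langle\Phi|\big)\big]<0$ for some maximally entangled $|\Phi\rangle$. For $\theta\in\mathbb R^{2d}$ let $|\phi(\theta)\rangle\in\mathcal H$ be the vector with coordinates $\theta_{j,0}+i\,\theta_{j,1}$ ($j$ running through the $d$ product basis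 vectors), let $\Theta$ be the set of $\theta\in[-1,1]^{2d}$ for which $|\phi(\theta)\rangle$ is maximally entangled, and put $$\mathcal M(\theta)=\Big(\sqrt{2-\tfrac{2}{\sqrt d}}\Big)^{-1}\Big(\frac{\mathbb I}{\sqrt d}-|\phi(\theta)\rangle\langle\phi(\theta)|\Big).$$ Then: 1. $\Pr_{\rho\sim\pi_{d,k}}[\rho\in\mathrm{FE}]=\Pr_{\rho\sim\pi_{d,k}}\big[\exists\,\theta\in\Theta:\ \operatorname{tr}(\rho\,\mathcal M(\theta))<0\big]<2\,e^{C_1-C_2k}$, where $C_1=3d\ln(4d)$ and $C_2=\Big(\sqrt{\tfrac12+\sqrt{\tfrac{d-\sqrt d}{2}}}-1\Big)^2$; 2. $C_2\sim\sqrt{d/2}$ as $d\to\infty$; 3. $\mathcal M$ is a normalized parameterized entanglement witness on $\Theta$: for every $\theta\in\Theta$, $\mathcal M(\theta)$ is Hermitian, $\|\mathcal M(\theta)\|_F=1$, and $\operatorname{tr}(\rho\,\mathcal M(\theta))\ge 0$ for all $\rho\in\mathrm{SEP}$. It is $\sqrt2$-Lipschitz, that is, $\|\mathcal M(\theta)-\mathcal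 M(\theta')\|_F\le\sqrt2\,\|\theta-\theta'\|_2$ for all $\theta,\theta'\in\Theta$, and $$\alpha_{\min}=\min_{\theta\in\Theta}\frac{\operatorname{tr}\mathcal M(\theta)}{\sqrt{\operatorname{tr}(\mathcal M(\theta)^2)}}=\sqrt{\frac{d-\sqrt d}{2}}.$$ -/

import Mathlib

open MeasureTheory Matrix Asymptotics Filter
open scoped Kronecker ComplexOrder

noncomputable section

/-- Operators on `ℂⁿ ⊗ ℂⁿ`, as matrices in the product basis. -/
abbrev BiOp (n : ℕ) : Type := Matrix (Fin n × Fin n) (Fin n × Fin n) ℂ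

/-- The Borel structure of `ℂ^(d×d)`: the product structure on the matrix entries. -/
instance biOpMeasurableSpace (n : ℕ) : MeasurableSpace (BiOp n) :=
  inferInstanceAs (MeasurableSpace (Fin n × Fin n → Fin n × Fin n → ℂ))

/-- `|ψ⟩⟨ψ|`. -/
def ketbra {ι : Type*} (ψ : ι → ℂ) : Matrix ι ι ℂ := vecMulVec ψ (star ψ)

/-- Density matrices: positive semidefinite of trace one. -/
def IsDensity {ι : Type*} [Fintype ι] (ρ : Matrix ι ι ℂ) : Prop :=
  ρ.PosSemidef ∧ ρ.trace = 1

/-- `|a⟩ ⊗ |b⟩`. -/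
def productVec {n : ℕ} (a b : Fin n → ℂ) : Fin n × Fin n → ℂ := fun p => a p.1 * b p.2

/-- The separable states: convex hull of the pure product states. -/
def SEP (n : ℕ) : Set (BiOp n) :=
  convexHull ℝ {ρ | ∃ a b : EuclideanSpace ℂ (Fin n),
    ‖a‖ = 1 ∧ ‖b‖ = 1 ∧ ρ = ketbra (productVec a b)}

/-- `n^{-1/2} ∑ᵢ |ii⟩`. -/
def canonicalMaxEntangled (n : ℕ) : Fin n × Fin n → ℂ :=
  fun p => if p.1 = p.2 then (((√(n : ℝ))⁻¹ : ℝ) : ℂ) else 0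

/-- Maximally entangled vectors: `(U_A ⊗ U_B) n^{-1/2} ∑ᵢ |ii⟩` with `U_A`, `U_B` unitary. -/
def IsMaxEntangled {n : ℕ} (Φ : Fin n × Fin n → ℂ) : Prop :=
  ∃ U ∈ unitaryGroup (Fin n) ℂ, ∃ V ∈ unitaryGroup (Fin n) ℂ,
    Φ = (U ⊗ₖ V) *ᵥ canonicalMaxEntangled n

/-- The observable `W` detects `ρ`, i.e. `tr (ρ W) < 0` (a real number for Hermitian `ρ`, `W`). -/
def Detects {n : ℕ} (W ρ : BiOp n) : Prop := (ρ * W).trace.re < 0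

/-- `𝕀/√d - |Φ⟩⟨Φ|` with `d = n²`. -/
def faithfulEW {n : ℕ} (Φ : Fin n × Fin n → ℂ) : BiOp n :=
  (((√((n : ℝ) ^ 2))⁻¹ : ℝ) : ℂ) • (1 : BiOp n) - ketbra Φ

/-- Faithfully entangled states: the entangled states that are detected by `𝕀/√d - |Φ⟩⟨Φ|`
for some maximally entangled `Φ`. -/
def FE (n : ℕ) : Set (BiOp n) :=
  {ρ | IsDensity ρ ∧ ρ ∉ SEP n ∧ ∃ Φ, IsMaxEntangled Φ ∧ Detects (faithfulEW Φ) ρ}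

/-- The uniform distribution on the unit sphere of `ℂ^ι` (normalised surface measure). -/
def uniformSphere (ι : Type*) [Fintype ι] :
    Measure (Metric.sphere (0 : EuclideanSpace ℂ ι) 1) :=
  ((volume : Measure (EuclideanSpace ℂ ι)).toSphere Set.univ)⁻¹ •
    (volume : Measure (EuclideanSpace ℂ ι)).toSphere

/-- `tr_R |φ⟩⟨φ|` for a vector `φ` of `ℂ^ι ⊗ ℂ^κ`. -/
def reducedState {ι κ : Type*} [Fintype κ] (φ : ι × κ → ℂ) : Matrix ι ι ℂ :=
  Matrix.of fun i j => ∑ r, ketbra φ (i, r) (j, r)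

/-- The distribution `π_{d,k}`, `d = n²`: the law of `tr_R |φ⟩⟨φ|` for a uniformly distributed unit
vector `φ` of `(ℂⁿ ⊗ ℂⁿ) ⊗ ℂᵏ`. -/
def inducedDist (n k : ℕ) : Measure (BiOp n) :=
  (uniformSphere ((Fin n × Fin n) × Fin k)).map fun φ => reducedState φ.1

theorem measurable_reducedState (n k : ℕ) :
    Measurable fun φ : Metric.sphere (0 : EuclideanSpace ℂ ((Fin n × Fin n) × Fin k)) 1 =>
      (reducedState φ.1 : BiOp n) := by
  have h : Continuous fun φ : Metric.sphere (0 : EuclideanSpace ℂ ((Fin n × Fin n) × Fin k)) 1 =>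
      (reducedState φ.1 : BiOp n) := by
    refine continuous_matrix fun i j => ?_
    simp only [reducedState, ketbra, Matrix.of_apply, vecMulVec_apply, Pi.star_apply]
    fun_prop
  refine measurable_pi_lambda _ fun i => measurable_pi_lambda _ fun j => ?_
  exact (h.matrix_elem i j).measurable

theorem isProbabilityMeasure_uniformSphere (ι : Type*) [Fintype ι] [Nonempty ι] :
    IsProbabilityMeasure (uniformSphere ι) := by
  refine ⟨?_⟩
  have h0 : (volume : Measure (EuclideanSpace ℂ ι)).toSphere Set.univ ≠ 0 := by
    rw [Ne, Measure.measure_univ_eq_zero]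
    exact Measure.toSphere_ne_zero _
  simp only [uniformSphere, Measure.smul_apply, smul_eq_mul]
  exact ENNReal.inv_mul_cancel h0 (measure_ne_top _ _)

theorem isProbabilityMeasure_inducedDist (n k : ℕ) (hn : 1 ≤ n) (hk : 1 ≤ k) :
    IsProbabilityMeasure (inducedDist n k) := by
  have : Nonempty ((Fin n × Fin n) × Fin k) := ⟨((⟨0, hn⟩, ⟨0, hn⟩), ⟨0, hk⟩)⟩
  have := isProbabilityMeasure_uniformSphere ((Fin n × Fin n) × Fin k)
  exact Measure.isProbabilityMeasure_map (measurable_reducedState n k).aemeasurable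

/-- The Frobenius norm. -/
def frobNorm {n : ℕ} (A : BiOp n) : ℝ := √(∑ i, ∑ j, ‖A i j‖ ^ 2)

/-- `M : Θ → operators` is a parameterized entanglement witness: `Θ ⊆ [-1,1]^σ` and every `M θ` with
`θ ∈ Θ` is Hermitian, has Frobenius norm one and is nonnegative on the separable states. -/
def IsParameterizedEW {n : ℕ} {σ : Type*} (Θ : Set (EuclideanSpace ℝ σ))
    (M : EuclideanSpace ℝ σ → BiOp n) : Prop :=
  (∀ θ ∈ Θ, ∀ s, θ s ∈ Set.Icc (-1 : ℝ) 1) ∧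
  ∀ θ ∈ Θ, (M θ).IsHermitian ∧ frobNorm (M θ) = 1 ∧ ∀ ρ ∈ SEP n, 0 ≤ (ρ * M θ).trace.re

/-- The detection capability of a parameterized witness:
`Pr_{ρ ∼ π_{d,k}} [∃ θ ∈ Θ, tr (ρ M(θ)) < 0]`. -/
def detectionCapability {n : ℕ} {σ : Type*} (k : ℕ) (Θ : Set (EuclideanSpace ℝ σ))
    (M : EuclideanSpace ℝ σ → BiOp n) : ℝ :=
  (inducedDist n k).real {ρ | ∃ θ ∈ Θ, Detects (M θ) ρ}

/-- `tr W / √(tr W²)`. -/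
def witnessAlpha {n : ℕ} (W : BiOp n) : ℝ := W.trace.re / √((W * W).trace.re)

/-- The `2d = 2n²` real parameters of a vector of `ℂⁿ ⊗ ℂⁿ`. -/
abbrev ParamSpace (n : ℕ) : Type := EuclideanSpace ℝ ((Fin n × Fin n) × Fin 2)

/-- `⟨j|φ(θ)⟩ = θ_{j,0} + i θ_{j,1}`. -/
def paramVec {n : ℕ} (θ : ParamSpace n) : Fin n × Fin n → ℂ :=
  fun j => (θ (j, 0) : ℂ) + Complex.I * (θ (j, 1) : ℂ)

/-- The feasible parameters of the faithful witnesses. -/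
def faithfulParams (n : ℕ) : Set (ParamSpace n) :=
  {θ | (∀ s, θ s ∈ Set.Icc (-1 : ℝ) 1) ∧ IsMaxEntangled (paramVec θ)}

/-- `M_faithful(θ) = (2 - 2/√d)^{-1/2} (𝕀/√d - |φ(θ)⟩⟨φ(θ)|)`, `d = n²`. -/
def faithfulMap {n : ℕ} (θ : ParamSpace n) : BiOp n :=
  (((√(2 - 2 / √((n : ℝ) ^ 2)))⁻¹ : ℝ) : ℂ) • faithfulEW (paramVec θ)

/-- `C₁ = 3 d ln (4 d)`. -/
def constC₁ (d : ℝ) : ℝ := 3 * d * Real.log (4 * d)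

/-- `C₂ = (√(0.5 + √((d - √d)/2)) - 1)²`. -/
def constC₂ (d : ℝ) : ℝ := (√(1 / 2 + √((d - √d) / 2)) - 1) ^ 2

end

/-! Probability bound. For `ρ = tr_R |φ⟩⟨φ|` with `φ` a unit vector, the witness of `Φ` detects `ρ`
exactly when `‖(⟨Φ| ⊗ 𝕀) φ‖² > 1/n`. So the event is that one of these overlaps is large, with `Φ`
ranging over a continuum, and it is handled by a tail bound for one vector plus a net.

Tail bound: for fixed `ψ ≠ 0`, the overlap is at least `(y/d) ‖ψ‖²` with probability at most `exp
(-(√y - 1)² k)` (`uniformSphere_partialOverlap_le`). This is a Chernoff bound without moment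
generating functions. An anisotropic Gaussian that dominates `exp (-‖v‖²)` on the cone over the
event is integrated in polar coordinates; the ratio of the two Gaussian integrals is a determinant.

Net: the square root of the overlap is a seminorm in `ψ`, so moving from a maximally entangled
vector to the nearest point of a grid of mesh `1/(7n²)` costs at most a factor `3/4` in relative
overlap (`partialOverlap_gridPoint_ge`). Since `1/2 + α_min ≤ 3n/4`, the tail bound applies with `y
= 1/2 + α_min`, whose rate is `C₂`; the grid has at most `exp C₁` points.

Witness properties: a maximally entangled vector is `n^{-1/2}` times the entries of a unitary
matrix. Cauchy–Schwarz then bounds its squared overlap with product states by `1/n`, and the traces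
are explicit. -/

/-! ### Polar coordinates and Gaussian integrals -/

/-- Polar coordinates: a nonnegative function that dominates a radial function `g` on the cone over
`A` has integral at least `toSphere A / toSphere univ` times the integral of `g`. -/
theorem toSphere_mul_lintegral_le {E : Type*} [NormedAddCommGroup E] [NormedSpace ℝ E]
    [MeasurableSpace E] [BorelSpace E] [FiniteDimensional ℝ E] [Nontrivial E]
    (μ : Measure E) [μ.IsAddHaarMeasure] {A : Set (Metric.sphere (0 : E) 1)}
    (hA : MeasurableSet A) {g : ℝ → ENNReal} (hg : Measurable g) {F : E → ENNReal}
    (hF : Measurable F)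
    (h : ∀ u ∈ A, ∀ r : ℝ, 0 < r → g r ≤ F (r • (u : E))) :
    μ.toSphere A * ∫⁻ v, g ‖v‖ ∂μ ≤ μ.toSphere Set.univ * ∫⁻ v, F v ∂μ := by
  have polar : ∀ f : E → ENNReal, Measurable f → ∫⁻ v, f v ∂μ =
      ∫⁻ p, f ((p.2 : ℝ) • (p.1 : E))
        ∂(μ.toSphere.prod (Measure.volumeIoiPow (Module.finrank ℝ E - 1))) := by
    intro f hf
    have h1 := μ.measurePreserving_homeomorphUnitSphereProd
    have h2 : ∫⁻ v, f v ∂μ = ∫⁻ v : ({0}ᶜ : Set E), f v ∂(μ.comap (↑)) := by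
      rw [lintegral_subtype_comap (measurableSet_singleton (0 : E)).compl,
        restrict_compl_singleton]
    have h3 : Measurable fun p : Metric.sphere (0 : E) 1 × Set.Ioi (0 : ℝ) =>
        f ((p.2 : ℝ) • (p.1 : E)) := by
      refine hf.comp ?_
      exact (measurable_subtype_coe.comp measurable_snd).smul
        (measurable_subtype_coe.comp measurable_fst)
    rw [h2, ← h1.lintegral_comp h3]
    refine lintegral_congr fun v => ?_
    congr 1
    rw [← homeomorphUnitSphereProd_symm_apply_coe, Homeomorph.symm_apply_apply]
  set ν := Measure.volumeIoiPow (Module.finrank ℝ E - 1)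
  set Z := ∫⁻ r : Set.Ioi (0 : ℝ), g r ∂ν
  have hgm : Measurable fun r : Set.Ioi (0 : ℝ) => g r := hg.comp measurable_subtype_coe
  have e1 : ∫⁻ v, g ‖v‖ ∂μ = μ.toSphere Set.univ * Z := by
    rw [polar (fun v => g ‖v‖) (hg.comp measurable_norm)]
    have : ∀ p : Metric.sphere (0 : E) 1 × Set.Ioi (0 : ℝ),
        g ‖(p.2 : ℝ) • (p.1 : E)‖ = 1 * g p.2 := by
      rintro ⟨u, r⟩
      have hu : ‖(u : E)‖ = 1 := by simp
      rw [norm_smul, hu, mul_one, Real.norm_of_nonneg (le_of_lt r.2), one_mul]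
    simp_rw [this]
    rw [lintegral_prod_mul aemeasurable_const hgm.aemeasurable, lintegral_one]
  have e2 : μ.toSphere A * Z ≤ ∫⁻ v, F v ∂μ := by
    rw [polar _ hF, ← lintegral_indicator_one hA, ← lintegral_prod_mul
      ((measurable_one.indicator hA).aemeasurable) hgm.aemeasurable]
    refine lintegral_mono fun p => ?_
    by_cases hp : p.1 ∈ A
    · simpa [hp] using h p.1 hp p.2 p.2.2
    · simp [hp]
  rw [e1, mul_left_comm]
  gcongr

theorem uniformSphere_mul_lintegral_le {ι : Type*} [Fintype ι] [Nonempty ι]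
    {A : Set (Metric.sphere (0 : EuclideanSpace ℂ ι) 1)}
    (hA : MeasurableSet A) {g : ℝ → ENNReal} (hg : Measurable g)
    {F : EuclideanSpace ℂ ι → ENNReal} (hF : Measurable F)
    (h : ∀ u ∈ A, ∀ r : ℝ, 0 < r → g r ≤ F (r • (u : EuclideanSpace ℂ ι))) :
    uniformSphere ι A * ∫⁻ v : EuclideanSpace ℂ ι, g ‖v‖ ≤ ∫⁻ v, F v := by
  have key := toSphere_mul_lintegral_le volume hA hg hF h
  have h0 : (volume : Measure (EuclideanSpace ℂ ι)).toSphere Set.univ ≠ 0 := by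
    rw [Ne, Measure.measure_univ_eq_zero]
    exact Measure.toSphere_ne_zero _
  simp only [uniformSphere, Measure.smul_apply, smul_eq_mul]
  rw [mul_assoc]
  calc _ ≤ _ := mul_le_mul_right key _
    _ = _ := by rw [← mul_assoc, ENNReal.inv_mul_cancel h0 (measure_ne_top _ _), one_mul]

/-- The value of this integral never matters: being nonzero and finite, it cancels from both sides
of the Chernoff comparison. -/
theorem lintegral_gaussian_ne {ι : Type*} [Fintype ι] :
    (∫⁻ v : EuclideanSpace ℂ ι, ENNReal.ofReal (Real.exp (-‖v‖ ^ 2))) ≠ 0 ∧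
    (∫⁻ v : EuclideanSpace ℂ ι, ENNReal.ofReal (Real.exp (-‖v‖ ^ 2))) ≠ ⊤ := by
  have h1 := GaussianFourier.integral_rexp_neg_mul_sq_norm (V := EuclideanSpace ℂ ι) one_pos
  simp only [neg_mul, one_mul] at h1
  have hpos : 0 < ∫ v : EuclideanSpace ℂ ι, Real.exp (-‖v‖ ^ 2) := by
    rw [h1]; positivity
  have hint : Integrable fun v : EuclideanSpace ℂ ι => Real.exp (-‖v‖ ^ 2) := by
    by_contra hc
    rw [integral_undef hc] at hpos
    exact hpos.false
  rw [← ofReal_integral_eq_lintegral_ofReal hint (ae_of_all _ fun _ => (Real.exp_pos _).le)]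
  exact ⟨by simpa using hpos, ENNReal.ofReal_ne_top⟩

/-- Change of variables by `diag (√c i)` in the basis `b`. Each complex coordinate counts as two
real ones, so the real determinant is `∏ c i` and not its square root. -/
theorem lintegral_gaussian_diagonal {ι : Type*} [Fintype ι]
    (b : OrthonormalBasis ι ℂ (EuclideanSpace ℂ ι)) {c : ι → ℝ} (hc : ∀ i, 0 < c i) :
    ∫⁻ v, ENNReal.ofReal (Real.exp (-∑ i, c i * ‖b.repr v i‖ ^ 2)) =
      ENNReal.ofReal (∏ i, c i)⁻¹ *
        ∫⁻ v : EuclideanSpace ℂ ι, ENNReal.ofReal (Real.exp (-‖v‖ ^ 2)) := by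
  classical
  let D : EuclideanSpace ℂ ι →ₗ[ℂ] EuclideanSpace ℂ ι :=
    Matrix.toLin b.toBasis b.toBasis (Matrix.diagonal fun i => ((√(c i) : ℝ) : ℂ))
  have hdet : LinearMap.det (D.restrictScalars ℝ) = ∏ i, c i := by
    rw [LinearMap.det_restrictScalars, LinearMap.det_toLin, Matrix.det_diagonal,
      Algebra.norm_complex_apply, map_prod]
    refine Finset.prod_congr rfl fun i _ => ?_
    rw [Complex.normSq_ofReal, Real.mul_self_sqrt (hc i).le]
  have hpos : 0 < ∏ i, c i := Finset.prod_pos fun i _ => hc i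
  have hrepr : ∀ v i, b.repr (D v) i = ((√(c i) : ℝ) : ℂ) * b.repr v i := by
    intro v i
    have := congrFun (Matrix.repr_toLin b.toBasis b.toBasis
      (Matrix.diagonal fun i => ((√(c i) : ℝ) : ℂ)) v) i
    simpa [Matrix.mulVec_diagonal, D] using this
  have hnorm : ∀ v, ‖D v‖ ^ 2 = ∑ i, c i * ‖b.repr v i‖ ^ 2 := by
    intro v
    rw [← b.repr.norm_map, EuclideanSpace.norm_sq_eq]
    refine Finset.sum_congr rfl fun i _ => ?_
    rw [hrepr, norm_mul, mul_pow, Complex.norm_real, Real.norm_of_nonneg (Real.sqrt_nonneg _),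
      Real.sq_sqrt (hc i).le]
  have hmeas : Measurable fun v : EuclideanSpace ℂ ι => ENNReal.ofReal (Real.exp (-‖v‖ ^ 2)) := by
    fun_prop
  have hmap := Measure.map_linearMap_addHaar_eq_smul_addHaar
    (volume : Measure (EuclideanSpace ℂ ι)) (f := D.restrictScalars ℝ) (by rw [hdet]; exact hpos.ne')
  have hDm : Measurable (D.restrictScalars ℝ) :=
    (LinearMap.continuous_of_finiteDimensional _).measurable
  have := lintegral_map (μ := volume) hmeas hDm
  rw [hmap, lintegral_smul_measure, hdet, abs_of_pos (inv_pos.2 hpos)] at this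
  rw [← smul_eq_mul, this]
  refine lintegral_congr fun v => ?_
  rw [← hnorm]; rfl

/-! ### Chernoff bound for the overlap with a fixed vector -/

/-- `‖(⟨ψ| ⊗ 𝕀) φ‖²`. -/
noncomputable def partialOverlap {ι κ : Type*} [Fintype ι] [Fintype κ] (ψ : ι → ℂ)
    (φ : ι × κ → ℂ) : ℝ :=
  ∑ r, ‖∑ i, star (ψ i) * φ (i, r)‖ ^ 2

/-- The left side is `y ((d - y)/(d - 1))^(d - 1)`. Applying `1 + x ≤ exp x` to the power gives `exp
(1 - y)`, and applying it to `√y` gives `y ≤ exp (2(√y - 1))`; the exponents add up to `-(√y - 1)²`.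
-/
theorem chernoff_rate_le {d : ℕ} (hd : 2 ≤ d) {y : ℝ} (hy : 1 ≤ y) (hyd : y < d) :
    (1 / y * (((d : ℝ) - 1) / (d - y)) ^ (d - 1))⁻¹ ≤ Real.exp (-(√y - 1) ^ 2) := by
  have hd' : (2 : ℝ) ≤ d := by exact_mod_cast hd
  have hy0 : 0 < y := by linarith
  have hcast : ((d - 1 : ℕ) : ℝ) = d - 1 := by
    rw [Nat.cast_sub (by omega)]; simp
  have h1 : ((d : ℝ) - y) / (d - 1) ≤ Real.exp ((1 - y) / (d - 1)) := by
    have := Real.add_one_le_exp ((1 - y) / ((d : ℝ) - 1))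
    refine le_trans (le_of_eq ?_) this
    have : (d : ℝ) - 1 ≠ 0 := by linarith
    field_simp
    ring
  have h2 : (((d : ℝ) - y) / (d - 1)) ^ (d - 1) ≤ Real.exp (1 - y) := by
    calc _ ≤ Real.exp ((1 - y) / (d - 1)) ^ (d - 1) :=
          pow_le_pow_left₀ (div_nonneg (by linarith) (by linarith)) h1 _
      _ = Real.exp (1 - y) := by
          rw [← Real.exp_nat_mul, hcast]
          congr 1
          have : (d : ℝ) - 1 ≠ 0 := by linarith
          field_simp
  have h3 : y ≤ Real.exp (2 * (√y - 1)) := by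
    have h4 : √y ≤ Real.exp (√y - 1) := by
      have := Real.add_one_le_exp (√y - 1)
      linarith
    calc y = √y ^ 2 := (Real.sq_sqrt hy0.le).symm
      _ ≤ Real.exp (√y - 1) ^ 2 := pow_le_pow_left₀ (Real.sqrt_nonneg _) h4 _
      _ = _ := by rw [← Real.exp_nat_mul]; norm_num
  calc (1 / y * (((d : ℝ) - 1) / (d - y)) ^ (d - 1))⁻¹
      = y * (((d : ℝ) - y) / (d - 1)) ^ (d - 1) := by
        rw [mul_inv, ← inv_pow, inv_div]; simp
    _ ≤ Real.exp (2 * (√y - 1)) * Real.exp (1 - y) :=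
        mul_le_mul h3 h2 (by
          have : 0 ≤ ((d : ℝ) - y) / (d - 1) := div_nonneg (by linarith) (by linarith)
          positivity) (Real.exp_pos _).le
    _ = Real.exp (-(√y - 1) ^ 2) := by
        rw [← Real.exp_add]
        congr 1
        nlinarith [Real.sq_sqrt hy0.le]

/-- The vectors `ψ ⊗ e_r` are orthonormal; they are placed at the indices `(i₀, r)` and completed to
a basis. In it the overlap with `ψ` is the squared norm of the block of coordinates over `i₀`, which
makes the tilted Gaussian diagonal. -/
theorem exists_orthonormalBasis_tensor {ι κ : Type*} [Fintype ι] [Fintype κ]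
    (ψ : EuclideanSpace ℂ ι) (hψ : ‖ψ‖ = 1) (i₀ : ι) :
    ∃ b : OrthonormalBasis (ι × κ) ℂ (EuclideanSpace ℂ (ι × κ)),
      ∀ φ r, b.repr φ (i₀, r) = ∑ i, star (ψ i) * φ (i, r) := by
  classical
  let v : ι × κ → EuclideanSpace ℂ (ι × κ) :=
    fun p => WithLp.toLp 2 fun q => if q.2 = p.2 then ψ q.1 else 0
  have hin : ∀ p φ, inner ℂ (v p) φ = ∑ i, star (ψ i) * φ (i, p.2) := by
    intro p φ
    rw [PiLp.inner_apply, Fintype.sum_prod_type]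
    refine Finset.sum_congr rfl fun i _ => ?_
    rw [Finset.sum_eq_single p.2]
    · simp [v, mul_comm]
    · intro r _ hr
      simp [v, hr]
    · simp
  have hself : ∑ i, star (ψ i) * ψ i = 1 := by
    have := EuclideanSpace.norm_sq_eq ψ
    rw [hψ] at this
    have h2 : ∀ i, star (ψ i) * ψ i = ((‖ψ i‖ ^ 2 : ℝ) : ℂ) := fun i => by
      rw [Complex.star_def, ← Complex.normSq_eq_conj_mul_self, Complex.normSq_eq_norm_sq]
    simp_rw [h2]
    rw [← Complex.ofReal_sum, ← this]
    simp
  have ho : Orthonormal ℂ (({p | p.1 = i₀} : Set (ι × κ)).domRestrict v) := by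
    rw [orthonormal_iff_ite]
    rintro ⟨⟨i, r⟩, hi⟩ ⟨⟨j, s⟩, hj⟩
    simp only [Set.mem_ofPred_eq] at hi hj
    subst hi hj
    simp only [Set.domRestrict_apply, hin]
    by_cases hrs : r = s
    · subst hrs; simpa [v] using hself
    · simp [v, hrs]
  obtain ⟨b, hb⟩ := ho.exists_orthonormalBasis_extension_of_card_eq (by simp)
  refine ⟨b, fun φ r => ?_⟩
  rw [b.repr_apply_apply, hb (i₀, r) rfl, hin]

theorem continuous_partialOverlap {ι κ : Type*} [Fintype ι] [Fintype κ] (ψ : ι → ℂ) :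
    Continuous fun φ : EuclideanSpace ℂ (ι × κ) => partialOverlap ψ φ := by
  unfold partialOverlap
  fun_prop

theorem uniformSphere_partialOverlap_le_of_norm_eq_one {ι κ : Type*} [Fintype ι] [Fintype κ]
    [Nonempty κ] (hd : 2 ≤ Fintype.card ι) (ψ : EuclideanSpace ℂ ι) (hψ : ‖ψ‖ = 1)
    {y : ℝ} (hy : 1 ≤ y) (hyd : y < Fintype.card ι) :
    uniformSphere (ι × κ) {φ | y / Fintype.card ι ≤ partialOverlap ψ φ.1} ≤
      ENNReal.ofReal (Real.exp (-(√y - 1) ^ 2 * Fintype.card κ)) := by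
  classical
  have : Nonempty ι := Fintype.card_pos_iff.1 (by omega)
  obtain ⟨i₀⟩ := this
  have : Nonempty ι := ⟨i₀⟩
  obtain ⟨b, hb⟩ := exists_orthonormalBasis_tensor (κ := κ) ψ hψ i₀
  set d := Fintype.card ι with hddef
  have hd' : (2 : ℝ) ≤ d := by exact_mod_cast hd
  have hy0 : 0 < y := by linarith
  -- The weights `α` along `ψ` and `β` elsewhere satisfy `α y/d + β (d - y)/d = 1`, so the quadratic
  -- form equals `‖v‖²` at relative overlap exactly `y/d`, and is at most that beyond it because `α
  -- ≤ β`. Under this constraint they maximise `α β^(d-1)`, hence give the best bound.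
  set α : ℝ := 1 / y
  set β : ℝ := ((d : ℝ) - 1) / (d - y) with hβ
  have hα0 : 0 < α := by positivity
  have hβ0 : 0 < β := div_pos (by linarith) (by linarith)
  have hα1 : α ≤ 1 := by rw [div_le_one hy0]; exact hy
  have hβ1 : 1 ≤ β := by rw [hβ, le_div_iff₀ (by linarith)]; linarith
  let c : ι × κ → ℝ := fun p => if p.1 = i₀ then α else β
  have hc : ∀ p, 0 < c p := fun p => by
    simp only [c]; split_ifs <;> assumption
  have hprod : ∏ p, c p = (α * β ^ (d - 1)) ^ Fintype.card κ := by
    have h : ∏ i, (if i = i₀ then α else β) = α * β ^ (d - 1) := by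
      rw [← Finset.mul_prod_erase Finset.univ _ (Finset.mem_univ i₀), if_pos rfl]
      congr 1
      rw [Finset.prod_congr rfl (g := fun _ => β)
        fun i hi => if_neg (Finset.ne_of_mem_erase hi), Finset.prod_const,
        Finset.card_erase_of_mem (Finset.mem_univ _), Finset.card_univ]
    rw [Fintype.prod_prod_type_right, Finset.prod_congr rfl fun _ _ => h, Finset.prod_const,
      Finset.card_univ]
  have hsum : ∀ φ : EuclideanSpace ℂ (ι × κ), ∑ p, c p * ‖b.repr φ p‖ ^ 2 =
      β * ‖φ‖ ^ 2 - (β - α) * partialOverlap ψ φ := by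
    intro φ
    have hn : ‖φ‖ ^ 2 = ∑ p, ‖b.repr φ p‖ ^ 2 := by
      rw [← b.repr.norm_map, EuclideanSpace.norm_sq_eq]
    have hp : partialOverlap ψ φ = ∑ p : ι × κ, if p.1 = i₀ then ‖b.repr φ p‖ ^ 2 else 0 := by
      rw [Fintype.sum_prod_type, Finset.sum_eq_single i₀]
      · simp [partialOverlap, hb]
      · intro i _ hi; simp [hi]
      · simp
    rw [hn, hp, Finset.mul_sum, Finset.mul_sum, ← Finset.sum_sub_distrib]
    refine Finset.sum_congr rfl fun p _ => ?_
    simp only [c]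
    split_ifs <;> ring
  have hA : MeasurableSet {φ : Metric.sphere (0 : EuclideanSpace ℂ (ι × κ)) 1 |
      y / d ≤ partialOverlap ψ φ.1} :=
    (isClosed_le continuous_const
      ((continuous_partialOverlap _).comp continuous_subtype_val)).measurableSet
  have key := uniformSphere_mul_lintegral_le hA
    (g := fun r => ENNReal.ofReal (Real.exp (-r ^ 2))) (by fun_prop)
    (F := fun v => ENNReal.ofReal (Real.exp (-∑ p, c p * ‖b.repr v p‖ ^ 2))) (by
      simp_rw [hsum]
      have := (continuous_partialOverlap (κ := κ) ψ).measurable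
      fun_prop)
    (by
      intro u hu r hr
      apply ENNReal.ofReal_le_ofReal
      apply Real.exp_le_exp.2
      have h1 : ∀ p, ‖b.repr (r • (u : EuclideanSpace ℂ (ι × κ))) p‖ ^ 2 =
          r ^ 2 * ‖b.repr u.1 p‖ ^ 2 := by
        intro p
        have : b.repr (r • (u : EuclideanSpace ℂ (ι × κ))) = (r : ℂ) • b.repr u.1 := by
          rw [← map_smul]; rfl
        rw [this, PiLp.smul_apply, norm_smul, mul_pow, Complex.norm_real, Real.norm_eq_abs, sq_abs]
      have h2 : ∑ p, c p * ‖b.repr (r • (u : EuclideanSpace ℂ (ι × κ))) p‖ ^ 2 =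
          r ^ 2 * ∑ p, c p * ‖b.repr u.1 p‖ ^ 2 := by
        rw [Finset.mul_sum]
        refine Finset.sum_congr rfl fun p _ => ?_
        rw [h1]; ring
      have hu1 : ‖u.1‖ = 1 := by simp
      have hu2 : y / d ≤ partialOverlap ψ u.1 := hu
      have h3 : ∑ p, c p * ‖b.repr u.1 p‖ ^ 2 ≤ 1 := by
        rw [hsum, hu1]
        have h4 : (β - α) * (y / d) ≤ (β - α) * partialOverlap ψ u.1 :=
          mul_le_mul_of_nonneg_left hu2 (by linarith)
        have h5 : β * 1 ^ 2 - (β - α) * (y / d) = 1 := by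
          have : (d : ℝ) - y ≠ 0 := by linarith
          have : (d : ℝ) ≠ 0 := by linarith
          simp only [hβ, α]
          field_simp
          ring
        linarith
      rw [h2]
      nlinarith [sq_nonneg r])
  rw [lintegral_gaussian_diagonal b hc] at key
  have hG := lintegral_gaussian_ne (ι := ι × κ)
  refine ((ENNReal.mul_le_mul_iff_left hG.1 hG.2).1 key).trans (ENNReal.ofReal_le_ofReal ?_)
  rw [hprod, ← inv_pow]
  have hrate := chernoff_rate_le hd hy hyd
  calc _ ≤ Real.exp (-(√y - 1) ^ 2) ^ Fintype.card κ :=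
        pow_le_pow_left₀ (by positivity) hrate _
    _ = _ := by rw [← Real.exp_nat_mul]; ring_nf

theorem partialOverlap_smul {ι κ : Type*} [Fintype ι] [Fintype κ] (c : ℝ) (ψ : ι → ℂ)
    (φ : ι × κ → ℂ) : partialOverlap (fun i => (c : ℂ) * ψ i) φ = c ^ 2 * partialOverlap ψ φ := by
  unfold partialOverlap
  rw [Finset.mul_sum]
  refine Finset.sum_congr rfl fun r _ => ?_
  have : ∑ i, star ((c : ℂ) * ψ i) * φ (i, r) = (c : ℂ) * ∑ i, star (ψ i) * φ (i, r) := by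
    rw [Finset.mul_sum]
    refine Finset.sum_congr rfl fun i _ => ?_
    simp; ring
  rw [this, norm_mul, mul_pow, Complex.norm_real, Real.norm_eq_abs, sq_abs]

/-- Homogeneous form, suited to grid points, which are not normalised and may vanish. -/
theorem uniformSphere_partialOverlap_le {ι κ : Type*} [Fintype ι] [Fintype κ]
    [Nonempty κ] (hd : 2 ≤ Fintype.card ι) (ψ : EuclideanSpace ℂ ι)
    {y : ℝ} (hy : 1 ≤ y) (hyd : y < Fintype.card ι) :
    uniformSphere (ι × κ)
        {φ | ψ ≠ 0 ∧ y / Fintype.card ι * ‖ψ‖ ^ 2 ≤ partialOverlap ψ φ.1} ≤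
      ENNReal.ofReal (Real.exp (-(√y - 1) ^ 2 * Fintype.card κ)) := by
  by_cases hψ : ψ = 0
  · simp [hψ]
  have hn : 0 < ‖ψ‖ := norm_pos_iff.2 hψ
  refine le_trans (measure_mono ?_) (uniformSphere_partialOverlap_le_of_norm_eq_one hd
    (((‖ψ‖⁻¹ : ℝ) : ℂ) • ψ) ?_ hy hyd)
  · rintro φ ⟨-, hφ⟩
    have h := partialOverlap_smul ‖ψ‖⁻¹ ψ φ.1
    change _ ≤ partialOverlap (fun i => ((‖ψ‖⁻¹ : ℝ) : ℂ) * ψ i) φ.1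
    rw [h, inv_pow, ← div_eq_inv_mul, le_div_iff₀ (by positivity)]
    exact hφ
  · rw [norm_smul, Complex.norm_real, norm_inv, norm_norm, inv_mul_cancel₀ hn.ne']

/-! ### Maximally entangled vectors as unitary matrices -/

theorem norm_sum_star_mul_le {ι : Type*} [Fintype ι] (u v : ι → ℂ) :
    ‖∑ i, star (u i) * v i‖ ^ 2 ≤ (∑ i, ‖u i‖ ^ 2) * ∑ i, ‖v i‖ ^ 2 := by
  have h := norm_inner_le_norm (𝕜 := ℂ) (WithLp.toLp 2 u) (WithLp.toLp 2 v)
  have h1 : inner ℂ (WithLp.toLp 2 u) (WithLp.toLp 2 v) = ∑ i, star (u i) * v i := by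
    rw [PiLp.inner_apply]
    exact Finset.sum_congr rfl fun i _ => mul_comm _ _
  rw [h1] at h
  calc _ ≤ (‖WithLp.toLp 2 u‖ * ‖WithLp.toLp 2 v‖) ^ 2 := pow_le_pow_left₀ (norm_nonneg _) h 2
    _ = _ := by rw [mul_pow, EuclideanSpace.norm_sq_eq, EuclideanSpace.norm_sq_eq]

/-- Vectorisation: `U ⊗ V` sends the identity matrix, read as a vector, to `U Vᵀ`, which is again
unitary. -/
theorem IsMaxEntangled.exists_unitary {n : ℕ} {Φ : Fin n × Fin n → ℂ} (h : IsMaxEntangled Φ) :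
    ∃ W ∈ unitaryGroup (Fin n) ℂ, ∀ p, Φ p = (((√(n : ℝ))⁻¹ : ℝ) : ℂ) * W p.1 p.2 := by
  obtain ⟨U, hU, V, hV, rfl⟩ := h
  refine ⟨U * Vᵀ, mul_mem hU ?_, fun p => ?_⟩
  · rw [mem_unitaryGroup_iff, star_eq_conjTranspose]
    have h1 := (mem_unitaryGroup_iff').1 hV
    rw [star_eq_conjTranspose] at h1
    have h2 := congrArg transpose h1
    rw [transpose_mul, transpose_one] at h2
    rw [← h2]
    congr 1
  · simp only [mulVec, dotProduct, canonicalMaxEntangled, kroneckerMap_apply,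
      Fintype.sum_prod_type, mul_ite, mul_zero, Finset.sum_ite_eq, Finset.mem_univ, if_true,
      Matrix.mul_apply, transpose_apply, Finset.mul_sum]
    exact Finset.sum_congr rfl fun i _ => by ring

theorem sum_norm_sq_unitary_row {n : ℕ} {W : Matrix (Fin n) (Fin n) ℂ}
    (hW : W ∈ unitaryGroup (Fin n) ℂ) (i : Fin n) : ∑ j, ‖W i j‖ ^ 2 = 1 := by
  have h := congrFun (congrFun (mem_unitaryGroup_iff.1 hW) i) i
  rw [Matrix.mul_apply, one_apply_eq] at h
  have h2 : ∀ j, W i j * (star W) j i = ((‖W i j‖ ^ 2 : ℝ) : ℂ) := fun j => by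
    rw [star_apply, Complex.star_def, Complex.mul_conj, Complex.normSq_eq_norm_sq]
  simp_rw [h2] at h
  exact_mod_cast h

theorem sum_norm_sq_unitary_mulVec {n : ℕ} {W : Matrix (Fin n) (Fin n) ℂ}
    (hW : W ∈ unitaryGroup (Fin n) ℂ) (v : Fin n → ℂ) :
    ∑ i, ‖(W *ᵥ v) i‖ ^ 2 = ∑ i, ‖v i‖ ^ 2 := by
  have h2 : ∀ w : Fin n → ℂ, ((∑ i, ‖w i‖ ^ 2 : ℝ) : ℂ) = star w ⬝ᵥ w := fun w => by
    rw [Complex.ofReal_sum]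
    refine Finset.sum_congr rfl fun i _ => ?_
    rw [Pi.star_apply, Complex.star_def, ← Complex.normSq_eq_conj_mul_self,
      Complex.normSq_eq_norm_sq]
  have h := mem_unitaryGroup_iff'.1 hW
  rw [star_eq_conjTranspose] at h
  have : ((∑ i, ‖(W *ᵥ v) i‖ ^ 2 : ℝ) : ℂ) = ((∑ i, ‖v i‖ ^ 2 : ℝ) : ℂ) := by
    rw [h2, h2, star_mulVec, dotProduct_mulVec, vecMul_vecMul, h, vecMul_one]
  exact_mod_cast this

theorem IsMaxEntangled.sum_norm_sq {n : ℕ} (hn : 1 ≤ n) {Φ : Fin n × Fin n → ℂ}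
    (h : IsMaxEntangled Φ) : ∑ p, ‖Φ p‖ ^ 2 = 1 := by
  obtain ⟨W, hW, hΦ⟩ := h.exists_unitary
  have hn' : (0 : ℝ) < n := by exact_mod_cast hn
  simp_rw [hΦ, norm_mul, mul_pow, Complex.norm_real, Real.norm_eq_abs, sq_abs, inv_pow,
    Real.sq_sqrt hn'.le]
  rw [← Finset.mul_sum, Fintype.sum_prod_type]
  simp_rw [sum_norm_sq_unitary_row hW]
  simp [hn'.ne']

theorem IsMaxEntangled.norm_apply_le {n : ℕ} (hn : 1 ≤ n) {Φ : Fin n × Fin n → ℂ}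
    (h : IsMaxEntangled Φ) (p : Fin n × Fin n) : ‖Φ p‖ ≤ 1 := by
  have h1 := Finset.single_le_sum (f := fun p => ‖Φ p‖ ^ 2) (fun _ _ => sq_nonneg _)
    (Finset.mem_univ p)
  rw [h.sum_norm_sq hn] at h1
  exact (sq_le_one_iff₀ (norm_nonneg _)).1 h1

/-- The overlap is `n^{-1/2} ⟨W b̄, a⟩` with `W` unitary, so Cauchy–Schwarz suffices. This is where
the threshold `1/√d = 1/n` of the witness comes from. -/
theorem IsMaxEntangled.overlap_productVec_le {n : ℕ} {Φ : Fin n × Fin n → ℂ}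
    (h : IsMaxEntangled Φ) (a b : Fin n → ℂ) :
    ‖∑ p, star (Φ p) * productVec a b p‖ ^ 2 ≤
      (n : ℝ)⁻¹ * ((∑ i, ‖a i‖ ^ 2) * ∑ i, ‖b i‖ ^ 2) := by
  obtain ⟨W, hW, hΦ⟩ := h.exists_unitary
  have h1 : ∑ p, star (Φ p) * productVec a b p =
      (((√(n : ℝ))⁻¹ : ℝ) : ℂ) * ∑ i, star ((W *ᵥ star b) i) * a i := by
    rw [Fintype.sum_prod_type, Finset.mul_sum]
    refine Finset.sum_congr rfl fun i _ => ?_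
    simp only [mulVec, dotProduct, star_sum, Finset.sum_mul, Finset.mul_sum]
    refine Finset.sum_congr rfl fun j _ => ?_
    rw [hΦ]
    simp only [productVec, star_mul', Pi.star_apply, Complex.star_def,
      Complex.conj_ofReal, Complex.conj_conj]
    ring
  rw [h1, norm_mul, mul_pow, Complex.norm_real, Real.norm_eq_abs, sq_abs, inv_pow,
    Real.sq_sqrt (Nat.cast_nonneg n)]
  refine mul_le_mul_of_nonneg_left ?_ (by positivity)
  refine (norm_sum_star_mul_le _ _).trans (le_of_eq ?_)
  rw [sum_norm_sq_unitary_mulVec hW, mul_comm]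
  simp

/-! ### Traces against witnesses and reduced states -/

theorem trace_mul_ketbra {ι : Type*} [Fintype ι] (ρ : Matrix ι ι ℂ) (Φ : ι → ℂ) :
    (ρ * ketbra Φ).trace = star Φ ⬝ᵥ (ρ *ᵥ Φ) := by
  rw [ketbra, mul_vecMulVec, trace_vecMulVec, dotProduct_comm]

theorem trace_mul_faithfulEW {n : ℕ} (ρ : BiOp n) (Φ : Fin n × Fin n → ℂ) :
    (ρ * faithfulEW Φ).trace.re = (n : ℝ)⁻¹ * ρ.trace.re - (star Φ ⬝ᵥ (ρ *ᵥ Φ)).re := by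
  rw [faithfulEW, mul_sub, trace_sub, trace_mul_ketbra, Real.sqrt_sq (Nat.cast_nonneg n),
    Matrix.mul_smul, mul_one, trace_smul, smul_eq_mul, Complex.sub_re, Complex.re_ofReal_mul]

theorem dotProduct_ketbra_mulVec {ι : Type*} [Fintype ι] (φ Φ : ι → ℂ) :
    star Φ ⬝ᵥ (ketbra φ *ᵥ Φ) = ((‖∑ i, star (Φ i) * φ i‖ ^ 2 : ℝ) : ℂ) := by
  rw [ketbra, vecMulVec_mulVec]
  have h : star φ ⬝ᵥ Φ = star (star Φ ⬝ᵥ φ) := star_dotProduct _ _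
  have h2 : star Φ ⬝ᵥ φ = ∑ i, star (Φ i) * φ i := rfl
  rw [dotProduct_smul, h, h2, op_smul_eq_mul, Complex.star_def, Complex.mul_conj,
    Complex.normSq_eq_norm_sq]

theorem trace_ketbra {ι : Type*} [Fintype ι] (φ : ι → ℂ) :
    (ketbra φ).trace = ((∑ i, ‖φ i‖ ^ 2 : ℝ) : ℂ) := by
  rw [ketbra, trace_vecMulVec, dotProduct, Complex.ofReal_sum]
  refine Finset.sum_congr rfl fun i _ => ?_
  rw [Pi.star_apply, Complex.star_def, Complex.mul_conj, Complex.normSq_eq_norm_sq]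

theorem reducedState_eq_sum {ι κ : Type*} [Fintype κ] (φ : ι × κ → ℂ) :
    reducedState φ = ∑ r, ketbra fun i => φ (i, r) := by
  ext i j
  simp [reducedState, Matrix.sum_apply, ketbra, vecMulVec_apply]

theorem dotProduct_reducedState_mulVec {ι κ : Type*} [Fintype ι] [Fintype κ] (φ : ι × κ → ℂ)
    (Φ : ι → ℂ) : star Φ ⬝ᵥ (reducedState φ *ᵥ Φ) = (partialOverlap Φ φ : ℂ) := by
  rw [reducedState_eq_sum, sum_mulVec, dotProduct_sum, partialOverlap, Complex.ofReal_sum]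
  exact Finset.sum_congr rfl fun r _ => dotProduct_ketbra_mulVec _ _

theorem trace_reducedState {ι κ : Type*} [Fintype ι] [Fintype κ]
    (φ : EuclideanSpace ℂ (ι × κ)) : (reducedState φ).trace = ((‖φ‖ ^ 2 : ℝ) : ℂ) := by
  rw [reducedState_eq_sum, trace_sum, EuclideanSpace.norm_sq_eq, Fintype.sum_prod_type_right,
    Complex.ofReal_sum]
  exact Finset.sum_congr rfl fun r _ => trace_ketbra _

theorem isDensity_reducedState {ι κ : Type*} [Fintype ι] [Fintype κ]
    {φ : EuclideanSpace ℂ (ι × κ)} (hφ : ‖φ‖ = 1) : IsDensity (reducedState φ) := by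
  refine ⟨?_, by rw [trace_reducedState, hφ]; simp⟩
  rw [reducedState_eq_sum]
  exact posSemidef_sum _ fun r _ => posSemidef_vecMulVec_self_star _

theorem detects_faithfulEW_reducedState {n : ℕ} {κ : Type*} [Fintype κ]
    {φ : EuclideanSpace ℂ ((Fin n × Fin n) × κ)} (hφ : ‖φ‖ = 1) (Φ : Fin n × Fin n → ℂ) :
    Detects (faithfulEW Φ) (reducedState φ) ↔ (n : ℝ)⁻¹ < partialOverlap Φ φ := by
  rw [Detects, trace_mul_faithfulEW, dotProduct_reducedState_mulVec, trace_reducedState, hφ,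
    Complex.ofReal_re, Complex.ofReal_re]
  simp

/-! ### Stability of the overlap and the parameter grid -/

/-- `√(partialOverlap ψ φ)` is the norm of `(⟨ψ| ⊗ 𝕀) φ`, which is additive in `ψ`: this is the
triangle inequality. -/
theorem sqrt_partialOverlap_le_add {ι κ : Type*} [Fintype ι] [Fintype κ] (ψ ψ' : ι → ℂ)
    (φ : ι × κ → ℂ) :
    √(partialOverlap ψ φ) ≤ √(partialOverlap ψ' φ) + √(partialOverlap (ψ - ψ') φ) := by
  let T : (ι → ℂ) → EuclideanSpace ℂ κ :=
    fun ψ => WithLp.toLp 2 fun r => ∑ i, star (ψ i) * φ (i, r)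
  have hT : ∀ ψ, √(partialOverlap ψ φ) = ‖T ψ‖ := fun ψ => by
    rw [EuclideanSpace.norm_eq]; rfl
  have hadd : T ψ = T ψ' + T (ψ - ψ') := by
    ext r
    simp only [T, PiLp.add_apply]
    rw [← Finset.sum_add_distrib]
    refine Finset.sum_congr rfl fun i _ => ?_
    simp only [Pi.sub_apply, star_sub]
    ring
  rw [hT, hT, hT, hadd]
  exact norm_add_le _ _

theorem partialOverlap_le {ι κ : Type*} [Fintype ι] [Fintype κ] (ψ : ι → ℂ)
    (φ : EuclideanSpace ℂ (ι × κ)) : partialOverlap ψ φ ≤ (∑ i, ‖ψ i‖ ^ 2) * ‖φ‖ ^ 2 := by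
  rw [EuclideanSpace.norm_sq_eq, Fintype.sum_prod_type_right, Finset.mul_sum,
    partialOverlap]
  exact Finset.sum_le_sum fun r _ => norm_sum_star_mul_le ψ fun i => φ (i, r)

theorem sum_norm_sq_paramVec {n : ℕ} (θ : ParamSpace n) :
    ∑ j, ‖paramVec θ j‖ ^ 2 = ‖θ‖ ^ 2 := by
  rw [EuclideanSpace.norm_sq_eq, Fintype.sum_prod_type fun s => ‖θ s‖ ^ 2]
  refine Finset.sum_congr rfl fun j _ => ?_
  rw [Fin.sum_univ_two, ← Complex.normSq_eq_norm_sq, Complex.normSq_apply, paramVec]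
  simp [sq]

theorem paramVec_sub {n : ℕ} (θ θ' : ParamSpace n) :
    paramVec (θ - θ') = paramVec θ - paramVec θ' := by
  ext j
  simp [paramVec]
  ring

/-- The point of the grid of mesh `1 / L` in the cube `[-1,1]^σ` with the given index. -/
noncomputable def gridPoint {σ : Type*} (L : ℕ) (m : σ → Fin (2 * L + 1)) : EuclideanSpace ℝ σ :=
  WithLp.toLp 2 fun s => ((m s : ℕ) - L : ℝ) / L

theorem exists_gridPoint_near {σ : Type*} [Fintype σ] {L : ℕ} (hL : 1 ≤ L)
    (θ : EuclideanSpace ℝ σ) (hθ : ∀ s, θ s ∈ Set.Icc (-1 : ℝ) 1) :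
    ∃ m, ‖θ - gridPoint L m‖ ^ 2 ≤ Fintype.card σ / (2 * L) ^ 2 := by
  have hL' : (1 : ℝ) ≤ L := by exact_mod_cast hL
  have h1 : ∀ s, ∃ m : Fin (2 * L + 1), |θ s - ((m : ℕ) - L : ℝ) / L| ≤ 1 / (2 * L) := by
    intro s
    obtain ⟨hl, hu⟩ := hθ s
    -- Rounding moves `θ s * L ∈ [-L, L]` by at most `1/2`, so by integrality the result stays in
    -- `[-L, L]` and, shifted by `L`, is a valid index.
    have hlo : -(L : ℤ) ≤ round (θ s * L) := by
      have h := abs_le.1 (abs_sub_round (θ s * L))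
      have : -(L : ℝ) ≤ θ s * L := by nlinarith
      have h3 : (-(L : ℤ) : ℝ) - 1 < round (θ s * L) := by push_cast; linarith [h.2]
      have h4 : -(L : ℤ) - 1 < round (θ s * L) := by exact_mod_cast h3
      linarith
    have hhi : round (θ s * L) ≤ (L : ℤ) := by
      have h := abs_le.1 (abs_sub_round (θ s * L))
      have : θ s * L ≤ L := by nlinarith
      have h3 : (round (θ s * L) : ℝ) < (L : ℤ) + 1 := by push_cast; linarith [h.1]
      have h4 : round (θ s * L) < (L : ℤ) + 1 := by exact_mod_cast h3
      linarith
    refine ⟨⟨(round (θ s * L) + L).toNat, by omega⟩, ?_⟩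
    have hc : (((round (θ s * L) + L).toNat : ℕ) : ℝ) = round (θ s * L) + L := by
      have : (((round (θ s * L) + L).toNat : ℕ) : ℤ) = round (θ s * L) + L :=
        Int.toNat_of_nonneg (by linarith)
      exact_mod_cast this
    have h5 : θ s - ((((round (θ s * L) + L).toNat : ℕ) : ℝ) - L) / L =
        (θ s * L - round (θ s * L)) / L := by
      rw [hc]; field_simp; ring
    change |θ s - ((((round (θ s * L) + L).toNat : ℕ) : ℝ) - L) / L| ≤ _
    rw [h5, abs_div, abs_of_pos (by linarith : (0 : ℝ) < L), div_le_iff₀ (by linarith)]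
    refine (abs_sub_round _).trans (le_of_eq ?_)
    field_simp
  choose m hm using h1
  refine ⟨m, ?_⟩
  rw [EuclideanSpace.norm_sq_eq]
  calc _ ≤ ∑ s : σ, (1 / (2 * L : ℝ)) ^ 2 := by
        refine Finset.sum_le_sum fun s _ => ?_
        rw [Real.norm_eq_abs]
        exact pow_le_pow_left₀ (abs_nonneg _) (hm s) 2
    _ = _ := by
        rw [Finset.sum_const, Finset.card_univ, nsmul_eq_mul, div_pow, one_pow, mul_one_div]

theorem exists_paramVec_eq {n : ℕ} (Φ : Fin n × Fin n → ℂ) : ∃ θ : ParamSpace n, paramVec θ = Φ := by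
  refine ⟨WithLp.toLp 2 fun s => if s.2 = 0 then (Φ s.1).re else (Φ s.1).im, ?_⟩
  ext j
  simp only [paramVec, if_true]
  rw [if_neg (by decide), mul_comm, Complex.re_add_im]

theorem abs_apply_le_norm_paramVec {n : ℕ} (θ : ParamSpace n) (s : (Fin n × Fin n) × Fin 2) :
    |θ s| ≤ ‖paramVec θ s.1‖ := by
  obtain ⟨j, i⟩ := s
  fin_cases i
  · simpa [paramVec] using Complex.abs_re_le_norm (paramVec θ j)
  · simpa [paramVec] using Complex.abs_im_le_norm (paramVec θ j)

/-- The box constraint is automatic, since a maximally entangled vector has norm one. -/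
theorem mem_faithfulParams_iff {n : ℕ} (hn : 1 ≤ n) (θ : ParamSpace n) :
    θ ∈ faithfulParams n ↔ IsMaxEntangled (paramVec θ) :=
  ⟨fun h => h.2, fun h => ⟨fun s => abs_le.1
    ((abs_apply_le_norm_paramVec θ s).trans (h.norm_apply_le hn s.1)), h⟩⟩

theorem faithfulParams_nonempty {n : ℕ} (hn : 1 ≤ n) : (faithfulParams n).Nonempty := by
  obtain ⟨θ, hθ⟩ := exists_paramVec_eq (canonicalMaxEntangled n)
  refine ⟨θ, (mem_faithfulParams_iff hn θ).2 ⟨1, one_mem _, 1, one_mem _, ?_⟩⟩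
  rw [hθ, one_kronecker_one, one_mulVec]

/-! ### Norm, trace, positivity and Lipschitz constant of the witnesses -/

theorem isHermitian_ketbra {ι : Type*} (φ : ι → ℂ) : (ketbra φ).IsHermitian := by
  rw [Matrix.IsHermitian, ketbra, conjTranspose_vecMulVec, star_star]

theorem isHermitian_ofReal_smul {ι : Type*} {A : Matrix ι ι ℂ} (hA : A.IsHermitian) (c : ℝ) :
    ((c : ℂ) • A).IsHermitian := by
  rw [Matrix.IsHermitian, conjTranspose_smul, hA.eq, Complex.star_def, Complex.conj_ofReal]

theorem isHermitian_faithfulEW {n : ℕ} (Φ : Fin n × Fin n → ℂ) : (faithfulEW Φ).IsHermitian :=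
  (isHermitian_ofReal_smul isHermitian_one _).sub (isHermitian_ketbra Φ)

theorem trace_ketbra_mul_ketbra {ι : Type*} [Fintype ι] (φ ψ : ι → ℂ) :
    (ketbra φ * ketbra ψ).trace = ((‖∑ i, star (ψ i) * φ i‖ ^ 2 : ℝ) : ℂ) := by
  rw [trace_mul_ketbra, dotProduct_ketbra_mulVec]

theorem sum_star_mul_self {ι : Type*} [Fintype ι] (φ : ι → ℂ) :
    ∑ i, star (φ i) * φ i = ((∑ i, ‖φ i‖ ^ 2 : ℝ) : ℂ) := by
  rw [Complex.ofReal_sum]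
  refine Finset.sum_congr rfl fun i _ => ?_
  rw [Complex.star_def, ← Complex.normSq_eq_conj_mul_self, Complex.normSq_eq_norm_sq]

theorem frobNorm_eq_of_isHermitian {n : ℕ} {A : BiOp n} (hA : A.IsHermitian) :
    frobNorm A = √((A * A).trace.re) := by
  rw [frobNorm]
  congr 1
  rw [trace, Complex.re_sum]
  refine Finset.sum_congr rfl fun i _ => ?_
  rw [diag_apply, Matrix.mul_apply, Complex.re_sum]
  refine Finset.sum_congr rfl fun j _ => ?_
  rw [← hA.apply j i, Complex.star_def, Complex.mul_conj, Complex.ofReal_re,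
    Complex.normSq_eq_norm_sq]

theorem trace_faithfulEW {n : ℕ} (hn : 1 ≤ n) {Φ : Fin n × Fin n → ℂ} (h : IsMaxEntangled Φ) :
    (faithfulEW Φ).trace = ((n - 1 : ℝ) : ℂ) := by
  have hn' : (n : ℂ) ≠ 0 := by exact_mod_cast (by omega : n ≠ 0)
  rw [faithfulEW, trace_sub, trace_ketbra, h.sum_norm_sq hn, Real.sqrt_sq (Nat.cast_nonneg n),
    trace_smul, trace_one]
  simp [hn']

theorem trace_faithfulEW_mul_self {n : ℕ} (hn : 1 ≤ n) {Φ : Fin n × Fin n → ℂ}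
    (h : IsMaxEntangled Φ) : (faithfulEW Φ * faithfulEW Φ).trace.re = 2 - 2 / n := by
  have hn' : (n : ℝ) ≠ 0 := by exact_mod_cast (by omega : n ≠ 0)
  rw [trace_mul_faithfulEW, trace_faithfulEW hn h, ← trace_mul_ketbra, faithfulEW, sub_mul,
    trace_sub, trace_ketbra_mul_ketbra, sum_star_mul_self, h.sum_norm_sq hn,
    Real.sqrt_sq (Nat.cast_nonneg n), smul_mul_assoc, one_mul, trace_smul, trace_ketbra,
    h.sum_norm_sq hn, Complex.ofReal_re, smul_eq_mul, Complex.sub_re, Complex.re_ofReal_mul]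
  simp
  field_simp
  ring

theorem one_le_two_sub_two_div {n : ℕ} (hn : 2 ≤ n) : (1 : ℝ) ≤ 2 - 2 / n := by
  have hn' : (2 : ℝ) ≤ n := by exact_mod_cast hn
  have : (2 : ℝ) / n ≤ 1 := by rw [div_le_one (by linarith)]; exact hn'
  linarith

theorem trace_ofReal_smul_mul_self_re {n : ℕ} (c : ℝ) (A : BiOp n) :
    (((c : ℂ) • A) * ((c : ℂ) • A)).trace.re = c ^ 2 * (A * A).trace.re := by
  rw [smul_mul_smul_comm, trace_smul, smul_eq_mul, ← Complex.ofReal_mul, Complex.re_ofReal_mul, sq]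

theorem trace_faithfulMap_mul_self {n : ℕ} (hn : 2 ≤ n) {θ : ParamSpace n}
    (h : IsMaxEntangled (paramVec θ)) : (faithfulMap θ * faithfulMap θ).trace.re = 1 := by
  have h1 := one_le_two_sub_two_div hn
  rw [faithfulMap, trace_ofReal_smul_mul_self_re, trace_faithfulEW_mul_self (by omega) h,
    Real.sqrt_sq (Nat.cast_nonneg n), inv_pow, Real.sq_sqrt (by linarith),
    inv_mul_cancel₀ (by linarith)]

theorem isHermitian_faithfulMap {n : ℕ} (θ : ParamSpace n) : (faithfulMap θ).IsHermitian :=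
  isHermitian_ofReal_smul (isHermitian_faithfulEW _) _

/-- The trace of the unnormalised witness is `n - 1` and its squared Frobenius norm `2 - 2/n`,
whatever `Φ` is. Thus the minimum defining `α_min` is over a constant function. -/
theorem witnessAlpha_faithfulMap {n : ℕ} (hn : 2 ≤ n) {θ : ParamSpace n}
    (h : IsMaxEntangled (paramVec θ)) :
    witnessAlpha (faithfulMap θ) = √(((n : ℝ) ^ 2 - √((n : ℝ) ^ 2)) / 2) := by
  have h1 := one_le_two_sub_two_div hn
  have hn' : (2 : ℝ) ≤ n := by exact_mod_cast hn
  rw [witnessAlpha, trace_faithfulMap_mul_self hn h, Real.sqrt_one, div_one, faithfulMap,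
    trace_smul, trace_faithfulEW (by omega) h, smul_eq_mul, ← Complex.ofReal_mul,
    Complex.ofReal_re, Real.sqrt_sq (Nat.cast_nonneg n)]
  symm
  rw [← Real.sqrt_sq (mul_nonneg (inv_nonneg.2 (Real.sqrt_nonneg (2 - 2 / (n : ℝ))))
    (by linarith : (0 : ℝ) ≤ n - 1))]
  congr 1
  rw [mul_pow, inv_pow, Real.sq_sqrt (by linarith)]
  have : (n : ℝ) - 1 ≠ 0 := by linarith
  have h2 : (2 : ℝ) - 2 / n = 2 * (n - 1) / n := by field_simp
  rw [h2]
  field_simp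

theorem convex_trace_mul_re_nonneg {n : ℕ} (W : BiOp n) :
    Convex ℝ {ρ : BiOp n | 0 ≤ (ρ * W).trace.re} := by
  refine convex_halfSpace_ge (f := fun ρ : BiOp n => (ρ * W).trace.re) ⟨fun x y => ?_, fun c x => ?_⟩ 0
  · simp only [add_mul, trace_add, Complex.add_re]
  · simp only [smul_mul_assoc, trace_smul, Complex.smul_re]

theorem faithfulEW_nonneg_on_SEP {n : ℕ} {Φ : Fin n × Fin n → ℂ} (h : IsMaxEntangled Φ)
    {ρ : BiOp n} (hρ : ρ ∈ SEP n) : 0 ≤ (ρ * faithfulEW Φ).trace.re := by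
  refine convexHull_min ?_ (convex_trace_mul_re_nonneg (faithfulEW Φ)) hρ
  rintro _ ⟨a, b, ha, hb, rfl⟩
  have ha2 := EuclideanSpace.norm_sq_eq a
  have hb2 := EuclideanSpace.norm_sq_eq b
  rw [ha] at ha2
  rw [hb] at hb2
  have h1 := h.overlap_productVec_le a b
  rw [← ha2, ← hb2] at h1
  have h2 : ∑ p, ‖productVec a b p‖ ^ 2 = 1 := by
    simp_rw [productVec, norm_mul, mul_pow]
    rw [Fintype.sum_prod_type]
    simp_rw [← Finset.mul_sum]
    rw [← Finset.sum_mul, ← ha2, ← hb2]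
    norm_num
  change 0 ≤ (ketbra (productVec a b) * faithfulEW Φ).trace.re
  rw [trace_mul_faithfulEW, dotProduct_ketbra_mulVec, trace_ketbra, h2, Complex.ofReal_re,
    Complex.ofReal_re]
  linarith

theorem trace_mul_faithfulMap {n : ℕ} (θ : ParamSpace n) (ρ : BiOp n) :
    (ρ * faithfulMap θ).trace.re =
      (√(2 - 2 / √((n : ℝ) ^ 2)))⁻¹ * (ρ * faithfulEW (paramVec θ)).trace.re := by
  rw [faithfulMap, Matrix.mul_smul, trace_smul, smul_eq_mul, Complex.re_ofReal_mul]

theorem isParameterizedEW_faithfulMap {n : ℕ} (hn : 2 ≤ n) :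
    IsParameterizedEW (faithfulParams n) faithfulMap := by
  refine ⟨fun θ hθ => hθ.1, fun θ hθ => ⟨isHermitian_faithfulMap θ, ?_, fun ρ hρ => ?_⟩⟩
  · rw [frobNorm_eq_of_isHermitian (isHermitian_faithfulMap θ),
      trace_faithfulMap_mul_self hn hθ.2, Real.sqrt_one]
  · rw [trace_mul_faithfulMap]
    exact mul_nonneg (inv_nonneg.2 (Real.sqrt_nonneg _)) (faithfulEW_nonneg_on_SEP hθ.2 hρ)

/-- With `o = ⟨φ'|φ⟩`, the projectors are at squared distance `2 - 2‖o‖²` and the parameters at `2 -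
2 Re o`; then `1 - ‖o‖² ≤ 2(1 - ‖o‖) ≤ 2(1 - Re o)`. The normalising factor is at most one because
`2 - 2/n ≥ 1`. -/
theorem frobNorm_faithfulMap_sub_le {n : ℕ} (hn : 2 ≤ n) {θ θ' : ParamSpace n}
    (h : IsMaxEntangled (paramVec θ)) (h' : IsMaxEntangled (paramVec θ')) :
    frobNorm (faithfulMap θ - faithfulMap θ') ≤ √2 * ‖θ - θ'‖ := by
  have h1 := one_le_two_sub_two_div hn
  set φ := paramVec θ
  set φ' := paramVec θ'
  set o := ∑ i, star (φ' i) * φ i with ho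
  have hsub : faithfulMap θ - faithfulMap θ' =
      (((√(2 - 2 / √((n : ℝ) ^ 2)))⁻¹ : ℝ) : ℂ) • (ketbra φ' - ketbra φ) := by
    rw [faithfulMap, faithfulMap, ← smul_sub, faithfulEW, faithfulEW, sub_sub_sub_cancel_left]
  have hherm : (faithfulMap θ - faithfulMap θ').IsHermitian :=
    (isHermitian_faithfulMap θ).sub (isHermitian_faithfulMap θ')
  have ho' : ∑ i, star (φ i) * φ' i = star o := by
    rw [ho, star_sum]
    refine Finset.sum_congr rfl fun i _ => ?_
    rw [star_mul, star_star]
  have htr : ((ketbra φ' - ketbra φ) * (ketbra φ' - ketbra φ)).trace.re = 2 - 2 * ‖o‖ ^ 2 := by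
    rw [sub_mul, mul_sub, mul_sub]
    simp only [trace_sub, trace_ketbra_mul_ketbra, sum_star_mul_self, ho']
    rw [h.sum_norm_sq (by omega), h'.sum_norm_sq (by omega), ← ho, norm_star]
    simp only [Complex.sub_re, Complex.ofReal_re]
    norm_num
    ring
  have hdist : ‖θ - θ'‖ ^ 2 = 2 - 2 * o.re := by
    rw [← sum_norm_sq_paramVec, paramVec_sub]
    have : ∀ i, ‖(φ - φ') i‖ ^ 2 = ‖φ i‖ ^ 2 + ‖φ' i‖ ^ 2 - 2 * (star (φ' i) * φ i).re := by
      intro i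
      simp only [Pi.sub_apply, ← Complex.normSq_eq_norm_sq, Complex.normSq_apply, Complex.sub_re,
        Complex.sub_im, Complex.mul_re, Complex.star_def, Complex.conj_re, Complex.conj_im]
      ring
    calc _ = ∑ i, ‖(φ - φ') i‖ ^ 2 := rfl
      _ = _ := by
        simp_rw [this]
        rw [Finset.sum_sub_distrib, Finset.sum_add_distrib, h.sum_norm_sq (by omega),
          h'.sum_norm_sq (by omega), ← Finset.mul_sum, ← Complex.re_sum]
        norm_num [ho]
  rw [frobNorm_eq_of_isHermitian hherm, hsub, trace_ofReal_smul_mul_self_re, htr,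
    Real.sqrt_sq (Nat.cast_nonneg n), inv_pow, Real.sq_sqrt (by linarith)]
  apply Real.sqrt_le_iff.2 ⟨by positivity, ?_⟩
  rw [mul_pow, Real.sq_sqrt (by norm_num), hdist]
  have hle : 2 - 2 * ‖o‖ ^ 2 ≤ 2 * (2 - 2 * o.re) := by
    nlinarith [Complex.re_le_norm o, sq_nonneg (1 - ‖o‖)]
  have hnn : 0 ≤ 2 * (2 - 2 * o.re) := by rw [← hdist]; positivity
  calc (2 - 2 / (n : ℝ))⁻¹ * (2 - 2 * ‖o‖ ^ 2)
      ≤ (2 - 2 / (n : ℝ))⁻¹ * (2 * (2 - 2 * o.re)) :=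
        mul_le_mul_of_nonneg_left hle (inv_nonneg.2 (by linarith))
    _ ≤ 1 * (2 * (2 - 2 * o.re)) := mul_le_mul_of_nonneg_right (inv_le_one_of_one_le₀ h1) hnn
    _ = _ := one_mul _

/-! ### Asymptotics of `C₂` -/

/-- In the variable `w = (d/2)^(-1/4)`, which tends to `0`, the ratio `C₂ / √(d/2)` becomes a
function continuous at `w = 0` with value `1` there. -/
theorem constC₂_isEquivalent : constC₂ ~[atTop] fun d : ℝ => √(d / 2) := by
  have hw : Tendsto (fun d : ℝ => (√(√(d / 2)))⁻¹) atTop (nhds 0) := by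
    refine tendsto_inv_atTop_zero.comp (Real.tendsto_sqrt_atTop.comp
      (Real.tendsto_sqrt_atTop.comp ?_))
    exact tendsto_id.atTop_div_const (by norm_num)
  have hcont : Continuous fun w : ℝ => (√(w ^ 2 / 2 + √(1 - w ^ 2 / √2)) - w) ^ 2 := by fun_prop
  have hlim := (hcont.tendsto 0).comp hw
  refine isEquivalent_of_tendsto_one ?_
  have h0 : (√((0 : ℝ) ^ 2 / 2 + √(1 - 0 ^ 2 / √2)) - 0) ^ 2 = 1 := by norm_num
  rw [h0] at hlim
  refine hlim.congr' ?_
  filter_upwards [eventually_gt_atTop 2] with d hd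
  set u := √(d / 2) with hu
  have hu0 : 0 < u := Real.sqrt_pos.2 (by linarith)
  have hd2 : d = 2 * u ^ 2 := by rw [hu, Real.sq_sqrt (by linarith)]; ring
  have hs2 : 0 < √(2 : ℝ) := by positivity
  have hss : √(2 : ℝ) * √2 = 2 := Real.mul_self_sqrt (by norm_num)
  have hsd : √d = √2 * u := by
    rw [hd2, Real.sqrt_mul (by norm_num), Real.sqrt_sq hu0.le]
  have hα : √((d - √d) / 2) = u * √(1 - u⁻¹ / √2) := by
    have : (d - √d) / 2 = u ^ 2 * (1 - u⁻¹ / √2) := by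
      rw [hsd, hd2]
      field_simp
      nlinarith
    rw [this, Real.sqrt_mul (sq_nonneg u), Real.sqrt_sq hu0.le]
  have hsu : √u ^ 2 = u := Real.sq_sqrt hu0.le
  have hsu0 : 0 < √u := Real.sqrt_pos.2 hu0
  simp only [Function.comp_apply, Pi.div_apply, constC₂]
  rw [hα, inv_pow, hsu]
  have : 1 / 2 + u * √(1 - u⁻¹ / √2) = u * (u⁻¹ / 2 + √(1 - u⁻¹ / √2)) := by
    field_simp
  rw [this, Real.sqrt_mul hu0.le, eq_div_iff hu0.ne']
  rw [← hu]
  generalize √(u⁻¹ / 2 + √(1 - u⁻¹ / √2)) = x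
  calc (x - (√u)⁻¹) ^ 2 * u = (x - (√u)⁻¹) ^ 2 * √u ^ 2 := by rw [hsu]
    _ = (√u * x - 1) ^ 2 := by
      rw [← mul_pow]
      congr 1
      field_simp

/-! ### Faithful entanglement as an event -/

theorem borelSpace_biOp (n : ℕ) : BorelSpace (BiOp n) :=
  inferInstanceAs (BorelSpace (Fin n × Fin n → Fin n × Fin n → ℂ))

theorem isClosed_setOf_isDensity {ι : Type*} [Fintype ι] :
    IsClosed {ρ : Matrix ι ι ℂ | IsDensity ρ} := by
  have h : {ρ : Matrix ι ι ℂ | IsDensity ρ} =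
      ({ρ | ρᴴ = ρ} ∩ ⋂ x : ι → ℂ, {ρ | 0 ≤ star x ⬝ᵥ (ρ *ᵥ x)}) ∩ {ρ | ρ.trace = 1} := by
    ext ρ
    simp [IsDensity, posSemidef_iff_dotProduct_mulVec, Matrix.IsHermitian]
  rw [h]
  refine ((isClosed_eq (by fun_prop) (by fun_prop)).inter (isClosed_iInter fun x => ?_)).inter
    (isClosed_eq (by fun_prop) (by fun_prop))
  exact isClosed_le continuous_const
    (continuous_const.dotProduct (continuous_id.matrix_mulVec continuous_const))

theorem ae_isDensity (n k : ℕ) : ∀ᵐ ρ ∂(inducedDist n k), IsDensity ρ := by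
  have := borelSpace_biOp n
  rw [inducedDist, ae_map_iff (measurable_reducedState n k).aemeasurable
    isClosed_setOf_isDensity.measurableSet]
  exact ae_of_all _ fun φ => isDensity_reducedState (by simp)

theorem detects_faithfulMap_iff {n : ℕ} (hn : 2 ≤ n) (θ : ParamSpace n) (ρ : BiOp n) :
    Detects (faithfulMap θ) ρ ↔ Detects (faithfulEW (paramVec θ)) ρ := by
  have h1 := one_le_two_sub_two_div hn
  rw [Detects, Detects, trace_mul_faithfulMap, Real.sqrt_sq (Nat.cast_nonneg n)]
  have hc : 0 < (√(2 - 2 / (n : ℝ)))⁻¹ := inv_pos.2 (Real.sqrt_pos.2 (by linarith))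
  exact ⟨fun h => (pos_iff_neg_of_mul_neg h).1 hc, mul_neg_of_pos_of_neg hc⟩

theorem exists_detects_faithfulMap_iff {n : ℕ} (hn : 2 ≤ n) (ρ : BiOp n) :
    (∃ θ ∈ faithfulParams n, Detects (faithfulMap θ) ρ) ↔
      ∃ Φ, IsMaxEntangled Φ ∧ Detects (faithfulEW Φ) ρ := by
  constructor
  · rintro ⟨θ, hθ, h⟩
    exact ⟨_, hθ.2, (detects_faithfulMap_iff hn θ ρ).1 h⟩
  · rintro ⟨Φ, hΦ, h⟩
    obtain ⟨θ, rfl⟩ := exists_paramVec_eq Φ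
    exact ⟨θ, (mem_faithfulParams_iff (by omega) θ).2 hΦ, (detects_faithfulMap_iff hn θ ρ).2 h⟩

/-- Reduced states are almost surely density matrices, and a detected state cannot be separable, so
only the detection condition in `FE` matters. -/
theorem inducedDist_FE_eq {n : ℕ} (k : ℕ) (hn : 2 ≤ n) :
    (inducedDist n k).real (FE n) = detectionCapability k (faithfulParams n) faithfulMap := by
  refine measureReal_congr ?_
  filter_upwards [ae_isDensity n k] with ρ hρ
  refine propext (Iff.trans ?_ (exists_detects_faithfulMap_iff hn ρ).symm)
  refine ⟨fun h => h.2.2, fun h => ⟨hρ, fun hsep => ?_, h⟩⟩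
  obtain ⟨Φ, hΦ, hd⟩ := h
  exact (faithfulEW_nonneg_on_SEP hΦ hsep).not_gt hd

theorem isOpen_setOf_exists_detects (n : ℕ) :
    IsOpen {ρ : BiOp n | ∃ Φ, IsMaxEntangled Φ ∧ Detects (faithfulEW Φ) ρ} := by
  have h : {ρ : BiOp n | ∃ Φ, IsMaxEntangled Φ ∧ Detects (faithfulEW Φ) ρ} =
      ⋃ Φ, ⋃ _ : IsMaxEntangled Φ, {ρ | (ρ * faithfulEW Φ).trace.re < 0} := by
    ext ρ
    simp [Detects]
  rw [h]
  exact isOpen_iUnion fun Φ => isOpen_iUnion fun _ => isOpen_lt (by fun_prop) continuous_const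

/-! ### Net argument and union bound -/

/-- The lower bound is needed for the tail bound. The upper one is an equality at `n = 2`, which
dictates the factor `3/4` that the grid must preserve. -/
theorem half_add_sqrt_bounds {n : ℕ} (hn : 2 ≤ n) :
    1 ≤ 1 / 2 + √(((n : ℝ) ^ 2 - √((n : ℝ) ^ 2)) / 2) ∧
      1 / 2 + √(((n : ℝ) ^ 2 - √((n : ℝ) ^ 2)) / 2) ≤ 3 * n / 4 := by
  have hn' : (2 : ℝ) ≤ n := by exact_mod_cast hn
  rw [Real.sqrt_sq (Nat.cast_nonneg n)]
  constructor
  · have : (1 / 2 : ℝ) ≤ √(((n : ℝ) ^ 2 - n) / 2) := Real.le_sqrt_of_sq_le (by nlinarith)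
    linarith
  · have : √(((n : ℝ) ^ 2 - n) / 2) ≤ 3 * n / 4 - 1 / 2 :=
      Real.sqrt_le_iff.2 ⟨by linarith, by nlinarith [sq_nonneg ((n : ℝ) - 2)]⟩
    linarith

theorem partialOverlap_gridPoint_ge {n : ℕ} {κ : Type*} [Fintype κ] (hn : 2 ≤ n)
    {θ η : ParamSpace n} (hθ : ‖θ‖ = 1) (hη : ‖θ - η‖ ^ 2 ≤ (98 * (n : ℝ) ^ 2)⁻¹)
    {φ : EuclideanSpace ℂ ((Fin n × Fin n) × κ)} (hφ : ‖φ‖ = 1)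
    (h : (n : ℝ)⁻¹ < partialOverlap (paramVec θ) φ) :
    η ≠ 0 ∧ 3 / (4 * n) * ‖η‖ ^ 2 ≤ partialOverlap (paramVec η) φ := by
  have hn' : (2 : ℝ) ≤ n := by exact_mod_cast hn
  set t := √(n : ℝ) with ht
  have ht2 : t ^ 2 = n := Real.sq_sqrt (by linarith)
  have ht1 : 1.41 ≤ t := Real.le_sqrt_of_sq_le (by linarith)
  -- `0.1021` exceeds `1/√98`; dividing by `t ≥ 1.41` once and twice gives the next two constants.
  have hε : ‖θ - η‖ * t ^ 2 ≤ 0.1021 := by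
    refine abs_le_of_sq_le_sq' ?_ (by norm_num) |>.2
    rw [ht2, mul_pow]
    calc ‖θ - η‖ ^ 2 * (n : ℝ) ^ 2 ≤ (98 * (n : ℝ) ^ 2)⁻¹ * (n : ℝ) ^ 2 := mul_le_mul_of_nonneg_right hη (sq_nonneg _)
      _ = 98⁻¹ := by field_simp
      _ ≤ _ := by norm_num
  set ε := ‖θ - η‖
  have hε0 : 0 ≤ ε := norm_nonneg _
  have hεt : ε * t ≤ 0.0725 := by nlinarith [mul_nonneg hε0 (by linarith : 0 ≤ t)]
  have hε1 : ε ≤ 0.0515 := by nlinarith [mul_nonneg hε0 (by linarith : 0 ≤ t)]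
  have hηn : ‖η‖ ≤ 1 + ε := by
    have := norm_sub_norm_le η θ
    rw [norm_sub_rev, hθ] at this
    linarith
  have h1 : √(partialOverlap (paramVec θ - paramVec η) φ) ≤ ε := by
    refine Real.sqrt_le_iff.2 ⟨hε0, ?_⟩
    refine (partialOverlap_le _ _).trans (le_of_eq ?_)
    rw [← paramVec_sub, sum_norm_sq_paramVec, hφ]
    ring
  have h2 := sqrt_partialOverlap_le_add (paramVec θ) (paramVec η) φ
  have h3 : t⁻¹ < √(partialOverlap (paramVec θ) φ) := by
    rw [ht, ← Real.sqrt_inv]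
    exact Real.sqrt_lt_sqrt (by positivity) h
  have h4 : (1 - ε * t) / t ≤ √(partialOverlap (paramVec η) φ) := by
    have : (1 - ε * t) / t = t⁻¹ - ε := by field_simp
    linarith
  -- `0.8661` is just above `√3/2`, so squaring yields `3/4`; there is room since `0.8661 (1 + ε) ≤
  -- 1 - ε t`.
  have h5 : 0.8661 * ‖η‖ / t ≤ √(partialOverlap (paramVec η) φ) := by
    refine le_trans ?_ h4
    gcongr
    linarith
  have hpos : 0 < √(partialOverlap (paramVec η) φ) :=
    lt_of_lt_of_le (div_pos (by linarith) (by linarith)) h4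
  constructor
  · rintro rfl
    have := partialOverlap_le (paramVec (0 : ParamSpace n)) φ
    rw [sum_norm_sq_paramVec, norm_zero] at this
    have h0 := Real.sqrt_pos.1 hpos
    linarith
  · have h6 := pow_le_pow_left₀ (by positivity) h5 2
    rw [Real.sq_sqrt (Real.sqrt_pos.1 hpos).le, div_pow, mul_pow, ht2] at h6
    refine le_trans ?_ h6
    rw [div_mul_eq_mul_div, div_le_div_iff₀ (by positivity) (by positivity)]
    have : 0 ≤ ‖η‖ ^ 2 * n := by positivity
    nlinarith

theorem norm_toLp_paramVec_sq {n : ℕ} (θ : ParamSpace n) :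
    ‖(WithLp.toLp 2 (paramVec θ) : EuclideanSpace ℂ (Fin n × Fin n))‖ ^ 2 = ‖θ‖ ^ 2 := by
  rw [EuclideanSpace.norm_sq_eq, ← sum_norm_sq_paramVec]

theorem inducedDist_FE_le {n k : ℕ} (hn : 2 ≤ n) (hk : 1 ≤ k) :
    inducedDist n k (FE n) ≤ ((2 * (7 * n ^ 2) + 1) ^ (n * n * 2) : ℕ) *
      ENNReal.ofReal (Real.exp (-constC₂ ((n : ℝ) ^ 2) * k)) := by
  have := borelSpace_biOp n
  have : Nonempty (Fin k) := ⟨⟨0, hk⟩⟩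
  have hn' : (2 : ℝ) ≤ n := by exact_mod_cast hn
  obtain ⟨hy1, hy2⟩ := half_add_sqrt_bounds hn
  set y : ℝ := 1 / 2 + √(((n : ℝ) ^ 2 - √((n : ℝ) ^ 2)) / 2) with hy
  have hC : constC₂ ((n : ℝ) ^ 2) = (√y - 1) ^ 2 := rfl
  have hcard : (Fintype.card (Fin n × Fin n) : ℝ) = n ^ 2 := by simp [sq]
  set L := 7 * n ^ 2 with hL
  let ψ : ((Fin n × Fin n) × Fin 2 → Fin (2 * L + 1)) → EuclideanSpace ℂ (Fin n × Fin n) :=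
    fun m => WithLp.toLp 2 (paramVec (gridPoint L m))
  -- Passing to the larger set of all detected matrices, which is open, provides the measurability
  -- needed to pull back to the sphere.
  calc inducedDist n k (FE n)
      ≤ inducedDist n k {ρ | ∃ Φ, IsMaxEntangled Φ ∧ Detects (faithfulEW Φ) ρ} :=
        measure_mono fun ρ h => h.2.2
    _ = uniformSphere ((Fin n × Fin n) × Fin k)
          {φ | ∃ Φ, IsMaxEntangled Φ ∧ Detects (faithfulEW Φ) (reducedState φ.1)} :=
        Measure.map_apply (measurable_reducedState n k)
          (isOpen_setOf_exists_detects n).measurableSet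
    _ ≤ uniformSphere ((Fin n × Fin n) × Fin k) (⋃ m, {φ | ψ m ≠ 0 ∧
          y / Fintype.card (Fin n × Fin n) * ‖ψ m‖ ^ 2 ≤ partialOverlap (ψ m) φ.1}) := by
        refine measure_mono ?_
        rintro φ ⟨Φ, hΦ, hdet⟩
        have hφ : ‖φ.1‖ = 1 := by simp
        rw [detects_faithfulEW_reducedState hφ] at hdet
        obtain ⟨θ, rfl⟩ := exists_paramVec_eq Φ
        have hθ : ‖θ‖ = 1 := by
          have := hΦ.sum_norm_sq (by omega)
          rw [sum_norm_sq_paramVec] at this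
          exact (pow_eq_one_iff_of_nonneg (norm_nonneg θ) two_ne_zero).1 this
        obtain ⟨m, hm⟩ := exists_gridPoint_near (L := L) (by rw [hL]; nlinarith) θ
          ((mem_faithfulParams_iff (by omega) θ).2 hΦ).1
        -- There are `2n²` real coordinates and `2L = 14n²`, so the bound is `2n²/(14n²)² =
        -- 1/(98n²)`.
        have hm' : ‖θ - gridPoint L m‖ ^ 2 ≤ (98 * (n : ℝ) ^ 2)⁻¹ := by
          refine hm.trans (le_of_eq ?_)
          simp only [Fintype.card_prod, Fintype.card_fin, hL]
          push_cast
          field_simp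
          norm_num
        obtain ⟨h0, hge⟩ := partialOverlap_gridPoint_ge hn hθ hm' hφ hdet
        refine Set.mem_iUnion.2 ⟨m, ?_, ?_⟩
        · intro hc
          apply h0
          rw [← norm_eq_zero, ← sq_eq_zero_iff, ← norm_toLp_paramVec_sq]
          change ‖ψ m‖ ^ 2 = 0
          simp [hc]
        · refine le_trans ?_ hge
          rw [← norm_toLp_paramVec_sq, hcard]
          refine mul_le_mul_of_nonneg_right ?_ (sq_nonneg _)
          rw [div_le_div_iff₀ (by positivity) (by positivity)]
          nlinarith
    _ ≤ ∑ m, uniformSphere ((Fin n × Fin n) × Fin k) {φ | ψ m ≠ 0 ∧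
          y / Fintype.card (Fin n × Fin n) * ‖ψ m‖ ^ 2 ≤ partialOverlap (ψ m) φ.1} :=
        measure_iUnion_fintype_le _ _
    _ ≤ ∑ m : ((Fin n × Fin n) × Fin 2 → Fin (2 * L + 1)),
          ENNReal.ofReal (Real.exp (-constC₂ ((n : ℝ) ^ 2) * k)) := by
        refine Finset.sum_le_sum fun m _ => ?_
        have := uniformSphere_partialOverlap_le (κ := Fin k) (by simp; nlinarith) (ψ m) hy1
          (by rw [hcard]; nlinarith)
        rwa [Fintype.card_fin k, ← hC] at this
    _ = _ := by simp

/-- `exp C₁ = (4d)^(3d) = ((2n)³)^(2n²)`, so it suffices that each coordinate takes `14n² + 1 ≤ 8n³`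
values, true from `n = 2` on. -/
theorem gridCard_le_exp_constC₁ {n : ℕ} (hn : 2 ≤ n) :
    (((2 * (7 * n ^ 2) + 1) ^ (n * n * 2) : ℕ) : ℝ) ≤ Real.exp (constC₁ ((n : ℝ) ^ 2)) := by
  have hn' : (2 : ℝ) ≤ n := by exact_mod_cast hn
  have h1 : (2 * (7 * (n : ℝ) ^ 2) + 1) ≤ (2 * n) ^ 3 := by
    nlinarith [mul_nonneg (sq_nonneg (n : ℝ)) (by linarith : (0 : ℝ) ≤ n - 2)]
  have h2 : Real.exp (constC₁ ((n : ℝ) ^ 2)) = ((2 * (n : ℝ)) ^ 3) ^ (n * n * 2) := by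
    have h3 : Real.log (4 * (n : ℝ) ^ 2) = 2 * Real.log (2 * n) := by
      rw [show 4 * (n : ℝ) ^ 2 = (2 * n) ^ 2 by ring, Real.log_pow]
      norm_num
    rw [← pow_mul, ← Real.exp_log (by positivity : 0 < (2 * (n : ℝ)) ^ (3 * (n * n * 2))),
      Real.log_pow, constC₁, h3]
    push_cast
    ring_nf
  rw [h2]
  push_cast
  exact pow_le_pow_left₀ (by positivity) h1 _

theorem inducedDist_FE_lt {n k : ℕ} (hn : 2 ≤ n) (hk : 1 ≤ k) :
    (inducedDist n k).real (FE n) <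
      2 * Real.exp (constC₁ ((n : ℝ) ^ 2) - constC₂ ((n : ℝ) ^ 2) * k) := by
  have h := ENNReal.toReal_mono (by finiteness) (inducedDist_FE_le hn hk)
  rw [ENNReal.toReal_mul, ENNReal.toReal_natCast, ENNReal.toReal_ofReal (Real.exp_pos _).le] at h
  calc _ ≤ _ := h
    _ ≤ Real.exp (constC₁ ((n : ℝ) ^ 2)) * Real.exp (-constC₂ ((n : ℝ) ^ 2) * k) :=
      mul_le_mul_of_nonneg_right (gridCard_le_exp_constC₁ hn) (Real.exp_pos _).le
    _ = Real.exp (constC₁ ((n : ℝ) ^ 2) - constC₂ ((n : ℝ) ^ 2) * k) := by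
      rw [← Real.exp_add]; ring_nf
    -- The union bound already holds without the factor `2`, which only makes the inequality strict.
    _ < _ := lt_two_mul_self (Real.exp_pos _)

theorem mainTheorem5 (n k : ℕ) (hn : 2 ≤ n) (hk : 1 ≤ k) :
    (inducedDist n k).real (FE n) = detectionCapability k (faithfulParams n) faithfulMap ∧
    (inducedDist n k).real (FE n) <
      2 * Real.exp (constC₁ ((n : ℝ) ^ 2) - constC₂ ((n : ℝ) ^ 2) * k) ∧
    (constC₂ ~[atTop] fun d : ℝ => √(d / 2)) ∧
    IsParameterizedEW (faithfulParams n) faithfulMap ∧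
    (∀ θ ∈ faithfulParams n, ∀ θ' ∈ faithfulParams n,
      frobNorm (faithfulMap θ - faithfulMap θ') ≤ √2 * ‖θ - θ'‖) ∧
    IsLeast ((fun θ => witnessAlpha (faithfulMap θ)) '' faithfulParams n)
      √(((n : ℝ) ^ 2 - √((n : ℝ) ^ 2)) / 2) := by
  refine ⟨inducedDist_FE_eq k hn, inducedDist_FE_lt hn hk, constC₂_isEquivalent,
    isParameterizedEW_faithfulMap hn,
    fun θ hθ θ' hθ' => frobNorm_faithfulMap_sub_le hn hθ.2 hθ'.2, ?_, ?_⟩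
  · obtain ⟨θ, hθ⟩ := faithfulParams_nonempty (n := n) (by omega)
    exact ⟨θ, hθ, witnessAlpha_faithfulMap hn hθ.2⟩
  · rintro _ ⟨θ, hθ, rfl⟩
    exact (witnessAlpha_faithfulMap hn hθ.2).ge
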